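/- For $n\ge 1$ let $P_n$ be the unweighted path with vertex set $\{1,\dots,n\}$, consecutive vertices being adjacent, let $A$ be its adjacency matrix, and let $U(t)=e^{itA}$, $t\in\mathbb{R}$. A vertex $u$ is called \emph{sedentary} if $\inf_{t>0}|U(t)_{u,u}|\ge C$ for some constant $0<C\le 1$, and \emph{not sedentary} if $\inf_{t>0}|U(t)_{u,u}|=0$. For all $n\ge 3$, no vertex of $P_n$ is sedentary, that is, $\inf_{t>0}|U(t)_{u,u}|=0$ for every vertex $u$ of $P_n$. Moreover, if $n\ge 3$ is odd and $u\in\{1,\dots,n\}$ is odd, then $U(\pi/\sqrt{2})_{u,u}$ is a real number and $U(\pi/\sqrt{2})_{u,u}\le 0$. -/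

import Mathlib

/-- The transition matrix `U(t) = exp(i t A)` of the continuous-time quantum walk on an unweighted
graph `G`, where `A` is the (0,1)-adjacency matrix of `G`. -/
noncomputable def transitionMatrix {V : Type*} [Fintype V] [DecidableEq V] (G : SimpleGraph V)
    [DecidableRel G.Adj] (t : ℝ) : Matrix V V ℂ :=
  NormedSpace.exp ((Complex.I * (t : ℂ)) • G.adjMatrix ℂ)

/-- The infimum of `|U(t)_{u,u}|` over all times `t > 0`. (The set of values is non-empty and
bounded below by `0`, so this is a genuine infimum.) -/
noncomputable def returnInf {V : Type*} [Fintype V] [DecidableEq V] (G : SimpleGraph V)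
    [DecidableRel G.Adj] (u : V) : ℝ :=
  sInf ((fun t : ℝ => ‖transitionMatrix G t u u‖) '' Set.Ioi 0)

/-- `u` is `C`-sedentary, for a constant `0 < C ≤ 1`. -/
def IsCSedentaryVertex {V : Type*} [Fintype V] [DecidableEq V] (G : SimpleGraph V)
    [DecidableRel G.Adj] (C : ℝ) (u : V) : Prop :=
  0 < C ∧ C ≤ 1 ∧ C ≤ returnInf G u

/-- `u` is sedentary: it is `C`-sedentary for some constant `0 < C ≤ 1`. -/
def IsSedentaryVertex {V : Type*} [Fintype V] [DecidableEq V] (G : SimpleGraph V)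
    [DecidableRel G.Adj] (u : V) : Prop :=
  ∃ C : ℝ, IsCSedentaryVertex G C u

/-- `u` is not sedentary: the infimum of `|U(t)_{u,u}|` over `t > 0` is `0`. -/
def IsNotSedentaryVertex {V : Type*} [Fintype V] [DecidableEq V] (G : SimpleGraph V)
    [DecidableRel G.Adj] (u : V) : Prop :=
  returnInf G u = 0

/-- The graph `G` is not sedentary: no vertex of `G` is sedentary. (This is not the mere negation
of "every vertex is sedentary".) -/
def IsNotSedentaryGraph {V : Type*} [Fintype V] [DecidableEq V] (G : SimpleGraph V)
    [DecidableRel G.Adj] : Prop :=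
  ∀ u : V, IsNotSedentaryVertex G u

/-- The two ways of saying that a vertex is not sedentary agree. -/
theorem isNotSedentaryVertex_iff {V : Type*} [Fintype V] [DecidableEq V] (G : SimpleGraph V)
    [DecidableRel G.Adj] (u : V) : IsNotSedentaryVertex G u ↔ ¬ IsSedentaryVertex G u := by
  have h0 : 0 ≤ returnInf G u := by
    apply Real.sInf_nonneg
    rintro _ ⟨t, _, rfl⟩
    exact norm_nonneg _
  constructor
  · rintro h ⟨C, hC, _, hle⟩
    unfold IsNotSedentaryVertex at h
    linarith
  · intro h
    by_contra hne
    have hpos : 0 < returnInf G u := lt_of_le_of_ne h0 (Ne.symm hne)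
    exact h ⟨min 1 (returnInf G u), lt_min one_pos hpos, min_le_left _ _, min_le_right _ _⟩

/-- Adjacency in the path on `{0, …, n-1}` (consecutive vertices are adjacent) is decidable. -/
instance instDecidableRelPathGraphAdj (n : ℕ) : DecidableRel (SimpleGraph.pathGraph n).Adj :=
  fun _ _ => decidable_of_iff' _ SimpleGraph.pathGraph_adj

/-!
The graph `G` is a path, `A` its adjacency matrix, `v_j` an orthonormal eigenbasis with eigenvalues
`θ_j`. Spectral decomposition gives `Re U(t)_{u,u} = ∑ j, |v_j(u)|² cos (θ_j t)`
(`transitionMatrix_apply_self_re`), and `U(t)_{u,u}` is real because a path is bipartite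
(`transitionMatrix_apply_self_im`).

*Odd `n`, end-point parity.* For all real `x`,
`cos (π x / √2) ≤ x⁴ / 2 - 2 x² + 1` (`cos_mul_pi_div_sqrt_two_le`); on the spectrum `x = 2 cos φ`
of a path the right-hand side is `cos 4φ`. Averaging over the spectral measure of `A` at `u` bounds
`U(π / √2)_{u,u}` by the diagonal entry `(A⁴ / 2 - 2 A² + 1)_{u,u}`, and counting closed walks shows
that this entry is exactly `0` (`adjMatrix_pathGraph_quartic_apply_self`). As `U(0)_{u,u} = 1`, the
intermediate value theorem then produces a positive time at which `U(t)_{u,u}` vanishes.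

*All other vertices.* A vector in the kernel of `A` vanishes at `u`
(`eq_zero_of_pathShift_eq_zero`), so only frequencies `θ_j ≠ 0` contribute. Then `U(t)_{u,u}` is the
derivative of a bounded function, and by the mean value theorem it takes arbitrarily small values
(`exists_abs_sum_mul_cos_le`).
-/

/-! ### Spectral decomposition of diagonal entries -/

open Matrix in
theorem Matrix.IsHermitian.conj_diagonal_apply_self {V : Type*} [Fintype V] [DecidableEq V]
    {A : Matrix V V ℂ} (hA : A.IsHermitian) (d : V → ℂ) (u : V) :
    ((hA.eigenvectorUnitary : Matrix V V ℂ) * diagonal d *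
      star (hA.eigenvectorUnitary : Matrix V V ℂ)) u u =
      ∑ j, ((‖hA.eigenvectorBasis j u‖ ^ 2 : ℝ) : ℂ) * d j := by
  rw [Matrix.mul_apply]
  refine Finset.sum_congr rfl fun j _ => ?_
  rw [Matrix.mul_diagonal, Matrix.star_apply, Matrix.IsHermitian.eigenvectorUnitary_apply,
    mul_right_comm, Complex.star_def, Complex.mul_conj, Complex.normSq_eq_norm_sq]

open Matrix in
theorem Matrix.IsHermitian.pow_apply_self {V : Type*} [Fintype V] [DecidableEq V]
    {A : Matrix V V ℂ} (hA : A.IsHermitian) (k : ℕ) (u : V) :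
    (A ^ k) u u = ((∑ j, ‖hA.eigenvectorBasis j u‖ ^ 2 * hA.eigenvalues j ^ k : ℝ) : ℂ) := by
  conv_lhs => rw [hA.spectral_theorem, ← map_pow, diagonal_pow, Unitary.conjStarAlgAut_apply,
    hA.conj_diagonal_apply_self]
  simp

open Matrix in
theorem Matrix.IsHermitian.exp_smul_apply_self {V : Type*} [Fintype V] [DecidableEq V]
    {A : Matrix V V ℂ} (hA : A.IsHermitian) (z : ℂ) (u : V) :
    NormedSpace.exp (z • A) u u =
      ∑ j, ((‖hA.eigenvectorBasis j u‖ ^ 2 : ℝ) : ℂ) * Complex.exp (z * hA.eigenvalues j) := by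
  have h : NormedSpace.exp (z • A) = (hA.eigenvectorUnitary : Matrix V V ℂ) *
      diagonal (NormedSpace.exp (z • (RCLike.ofReal ∘ hA.eigenvalues : V → ℂ))) *
      star (hA.eigenvectorUnitary : Matrix V V ℂ) := by
    conv_lhs => rw [hA.spectral_theorem, ← map_smul, Unitary.conjStarAlgAut_apply,
      ← diagonal_smul]
    have := Matrix.exp_units_conj (Unitary.toUnits hA.eigenvectorUnitary)
      (diagonal (z • (RCLike.ofReal ∘ hA.eigenvalues : V → ℂ)))
    rw [Matrix.exp_diagonal] at this
    exact this
  rw [h, hA.conj_diagonal_apply_self]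
  refine Finset.sum_congr rfl fun j _ => ?_
  rw [Pi.exp_def, Complex.exp_eq_exp_ℂ]
  simp

/-! ### Diagonal entries of the transition matrix -/

theorem isHermitian_adjMatrix {V : Type*} (G : SimpleGraph V) [DecidableRel G.Adj] :
    (G.adjMatrix ℂ).IsHermitian := by
  ext i j
  simp [SimpleGraph.adjMatrix_apply, G.adj_comm, apply_ite]

theorem transitionMatrix_apply_self_re {V : Type*} [Fintype V] [DecidableEq V]
    (G : SimpleGraph V) [DecidableRel G.Adj] (t : ℝ) (u : V) :
    (transitionMatrix G t u u).re =
      ∑ j, ‖(isHermitian_adjMatrix G).eigenvectorBasis j u‖ ^ 2 *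
        Real.cos ((isHermitian_adjMatrix G).eigenvalues j * t) := by
  rw [transitionMatrix, (isHermitian_adjMatrix G).exp_smul_apply_self, Complex.re_sum]
  refine Finset.sum_congr rfl fun j _ => ?_
  rw [Complex.re_ofReal_mul, Complex.exp_re]
  simp [mul_comm]

open Matrix in
/-- On a bipartite graph, conjugation by the diagonal sign matrix of a 2-colouring sends `A` to `-A`,
hence `U(t)` to `U(-t)`, the conjugate transpose of `U(t)`, without changing the diagonal. -/
theorem transitionMatrix_apply_self_im {V : Type*} [Fintype V] [DecidableEq V]
    (G : SimpleGraph V) [DecidableRel G.Adj] (c : G.Coloring Bool) (t : ℝ) (u : V) :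
    (transitionMatrix G t u u).im = 0 := by
  set s : V → ℂ := fun v => if c v then 1 else -1 with hs
  have hss : ∀ v, s v * s v = 1 := fun v => by by_cases h : c v <;> simp [hs, h]
  have hDD : diagonal s * diagonal s = 1 := by
    rw [diagonal_mul_diagonal, ← diagonal_one]
    exact congrArg _ (funext hss)
  have hinv : (diagonal s)⁻¹ = diagonal s := Matrix.inv_eq_left_inv hDD
  have hunit : IsUnit (diagonal s) := ⟨⟨_, _, hDD, hDD⟩, rfl⟩
  have hconj : diagonal s * ((Complex.I * (t : ℂ)) • G.adjMatrix ℂ) * (diagonal s)⁻¹ =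
      ((Complex.I * (t : ℂ)) • G.adjMatrix ℂ)ᴴ := by
    rw [hinv, conjTranspose_smul, (isHermitian_adjMatrix G).eq]
    ext i j
    rw [mul_diagonal, diagonal_mul]
    by_cases h : G.Adj i j
    · have hne : c i ≠ c j := c.valid h
      cases hi : c i <;> cases hj : c j <;> simp_all [SimpleGraph.adjMatrix_apply]
    · simp [SimpleGraph.adjMatrix_apply, h]
  have h := Matrix.exp_conj (diagonal s) ((Complex.I * (t : ℂ)) • G.adjMatrix ℂ) hunit
  rw [hconj, Matrix.exp_conjTranspose, hinv] at h
  have h' := congrFun (congrFun h u) u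
  rw [mul_diagonal, diagonal_mul, conjTranspose_apply, mul_right_comm, hss, one_mul] at h'
  exact Complex.conj_eq_iff_im.mp h'

theorem isNotSedentaryVertex_of_forall_exists {V : Type*} [Fintype V] [DecidableEq V]
    (G : SimpleGraph V) [DecidableRel G.Adj] (u : V)
    (h : ∀ ε > 0, ∃ t > 0, ‖transitionMatrix G t u u‖ ≤ ε) : IsNotSedentaryVertex G u := by
  have hbdd : BddBelow ((fun t : ℝ => ‖transitionMatrix G t u u‖) '' Set.Ioi 0) :=
    ⟨0, by rintro _ ⟨t, -, rfl⟩; exact norm_nonneg _⟩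
  refine le_antisymm (le_of_forall_pos_le_add fun ε hε => ?_)
    (Real.sInf_nonneg (by rintro _ ⟨t, -, rfl⟩; exact norm_nonneg _))
  obtain ⟨t, ht, hle⟩ := h ε hε
  rw [zero_add]
  exact (csInf_le hbdd ⟨t, ht, rfl⟩).trans hle

/-! ### Two analytic facts -/

/-- A trigonometric polynomial without constant term is the derivative of a bounded function, so its
mean value over a long interval, attained somewhere by the mean value theorem, is small. -/
theorem exists_abs_sum_mul_cos_le {ι : Type*} (s : Finset ι) (w θ : ι → ℝ)
    (h : ∀ j ∈ s, θ j = 0 → w j = 0) {ε : ℝ} (hε : 0 < ε) :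
    ∃ t > 0, |∑ j ∈ s, w j * Real.cos (θ j * t)| ≤ ε := by
  set F : ℝ → ℝ := fun t => ∑ j ∈ s, w j / θ j * Real.sin (θ j * t) with hF
  have hderiv : ∀ t, HasDerivAt F (∑ j ∈ s, w j * Real.cos (θ j * t)) t := by
    intro t
    refine HasDerivAt.fun_sum fun j hj => ?_
    have h1 := (((hasDerivAt_id t).const_mul (θ j)).sin).const_mul (w j / θ j)
    have h2 : w j / θ j * (Real.cos (θ j * t) * (θ j * 1)) = w j * Real.cos (θ j * t) := by
      by_cases h0 : θ j = 0
      · simp [h0, h j hj h0]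
      · field_simp
    rw [← h2]
    exact h1
  set M := ∑ j ∈ s, |w j / θ j| with hM
  have hM0 : 0 ≤ M := Finset.sum_nonneg fun _ _ => abs_nonneg _
  have hFM : ∀ t, |F t| ≤ M := fun t =>
    (Finset.abs_sum_le_sum_abs _ _).trans <| Finset.sum_le_sum fun j _ => by
      rw [abs_mul]
      exact mul_le_of_le_one_right (abs_nonneg _) (Real.abs_sin_le_one _)
  -- Adding `1` to `M` keeps the length of the interval `[0, (M + 1) / ε]` positive.
  have hT : 0 < (M + 1) / ε := by positivity
  obtain ⟨t, ht, hslope⟩ := exists_hasDerivAt_eq_slope F _ hT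
    (fun x _ => (hderiv x).continuousAt.continuousWithinAt) (fun x _ => hderiv x)
  refine ⟨t, ht.1, ?_⟩
  have hF0 : F 0 = 0 := by simp [hF]
  rw [hslope, hF0, sub_zero, sub_zero, abs_div, abs_of_pos hT, div_le_iff₀ hT,
    mul_div_cancel₀ _ hε.ne']
  linarith [hFM ((M + 1) / ε)]

/-- Equality holds at `s = 0` and `s = ±1`. Between `0` and `1` this is concavity of `sin` on
`[0, π / 4]`; beyond `1` it is `|sin y| ≤ |y|`. -/
theorem abs_cos_pi_div_two_mul_le (s : ℝ) : |Real.cos (Real.pi / 2 * s)| ≤ |1 - s ^ 2| := by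
  wlog hs : 0 ≤ s generalizing s
  · simpa using this (-s) (by linarith)
  rcases le_total s 1 with h1 | h1
  · have hpi := Real.pi_pos
    have hnn : 0 ≤ Real.cos (Real.pi / 2 * s) :=
      Real.cos_nonneg_of_mem_Icc ⟨by nlinarith, by nlinarith⟩
    rw [abs_of_nonneg hnn, abs_of_nonneg (by nlinarith)]
    have hconc := strictConcaveOn_sin_Icc.concaveOn.2
      (show (0 : ℝ) ∈ Set.Icc 0 Real.pi from ⟨le_rfl, hpi.le⟩)
      (show Real.pi / 4 ∈ Set.Icc 0 Real.pi from ⟨by positivity, by linarith⟩)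
      (sub_nonneg.mpr h1) hs (by ring)
    simp only [smul_eq_mul, mul_zero, zero_add, Real.sin_zero, Real.sin_pi_div_four] at hconc
    have hsq := pow_le_pow_left₀ (by positivity) hconc 2
    rw [mul_pow, div_pow, Real.sq_sqrt (by norm_num)] at hsq
    have hcos : Real.cos (Real.pi / 2 * s) = 1 - 2 * Real.sin (s * (Real.pi / 4)) ^ 2 := by
      rw [show Real.pi / 2 * s = 2 * (s * (Real.pi / 4)) by ring, Real.cos_two_mul,
        Real.cos_sq']
      ring
    rw [hcos]
    linarith
  · have hcos : Real.cos (Real.pi / 2 * s) = -Real.sin (Real.pi / 2 * (s - 1)) := by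
      rw [← Real.cos_add_pi_div_two]
      congr 1; ring
    rw [hcos, abs_neg, abs_of_nonpos (by nlinarith : 1 - s ^ 2 ≤ 0)]
    refine Real.abs_sin_le_abs.trans ?_
    rw [abs_of_nonneg (by have := Real.pi_pos; nlinarith)]
    nlinarith [Real.pi_le_four]

/-- The square of `abs_cos_pi_div_two_mul_le` at `s = x / √2`. -/
theorem cos_mul_pi_div_sqrt_two_le (x : ℝ) :
    Real.cos (x * (Real.pi / √2)) ≤ x ^ 4 / 2 - 2 * x ^ 2 + 1 := by
  have h2 : √2 ^ 2 = 2 := Real.sq_sqrt (by norm_num)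
  have h0 : √2 ≠ 0 := by positivity
  have h := sq_le_sq.mpr (abs_cos_pi_div_two_mul_le (x / √2))
  rw [div_pow, h2] at h
  rw [show x * (Real.pi / √2) = 2 * (Real.pi / 2 * (x / √2)) by field_simp, Real.cos_two_mul]
  nlinarith

/-! ### Walks on the path -/

/-- The adjacency operator of the path on `{0, …, n - 1}`, acting on functions on `ℕ` by adding the
values at the neighbours. Working on `ℕ` avoids arithmetic in `Fin n`; only the values at `i < n`
are meaningful. -/
noncomputable def pathShift (n : ℕ) (x : ℕ → ℂ) (i : ℕ) : ℂ :=
  (if 0 < i then x (i - 1) else 0) + (if i + 1 < n then x (i + 1) else 0)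

open Matrix in
theorem adjMatrix_pathGraph_mulVec (n : ℕ) (x : ℕ → ℂ) :
    (SimpleGraph.pathGraph n).adjMatrix ℂ *ᵥ (fun j : Fin n => x j) =
      fun i : Fin n => pathShift n x i := by
  ext i
  have hsplit : ∀ j : ℕ, (if (i : ℕ) + 1 = j ∨ j + 1 = i then (1 : ℂ) else 0) * x j =
      (if j = i - 1 then if 0 < (i : ℕ) then x j else 0 else 0) +
        (if j = i + 1 then x j else 0) := by
    intro j
    split_ifs <;> first | omega | simp
  have hi := i.isLt
  simp only [mulVec, dotProduct, SimpleGraph.adjMatrix_apply, SimpleGraph.pathGraph_adj,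
    pathShift]
  rw [Fin.sum_univ_eq_sum_range
    (fun j => (if (i : ℕ) + 1 = j ∨ j + 1 = i then (1 : ℂ) else 0) * x j) n]
  simp only [hsplit, Finset.sum_add_distrib, Finset.sum_ite_eq', Finset.mem_range]
  congr 1
  rw [if_pos (by omega)]

open Matrix in
theorem adjMatrix_pathGraph_pow_apply_self (n k : ℕ) (u : Fin n) :
    ((SimpleGraph.pathGraph n).adjMatrix ℂ ^ k) u u =
      (pathShift n)^[k] (fun j => if j = u then 1 else 0) u := by
  have h : ∀ (k : ℕ) (x : ℕ → ℂ), (SimpleGraph.pathGraph n).adjMatrix ℂ ^ k *ᵥ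
      (fun j : Fin n => x j) = fun i : Fin n => (pathShift n)^[k] x i := by
    intro k
    induction k with
    | zero => intro x; simp
    | succ k ih =>
      intro x
      rw [pow_succ, ← mulVec_mulVec, adjMatrix_pathGraph_mulVec, ih, Function.iterate_succ_apply]
  have h1 := congrFun (h k fun j => if j = u then 1 else 0) u
  rw [← h1]
  simp [mulVec, dotProduct, Fin.val_inj]

/-- The square of the adjacency operator, for odd `n`, restricted to even positions: an even position
has a left (right) neighbour exactly when it has an even position on its left (right). -/
theorem pathShift_pathShift_apply {n : ℕ} (hodd : Odd n) (x : ℕ → ℂ) {i : ℕ} (hi : i < n)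
    (heven : Even i) :
    pathShift n (pathShift n x) i =
      (if 2 ≤ i then x (i - 2) + x i else 0) + (if i + 2 < n then x i + x (i + 2) else 0) := by
  obtain ⟨a, rfl⟩ := heven
  obtain ⟨c, rfl⟩ := hodd
  have hlow : 0 < a + a ↔ 2 ≤ a + a := by omega
  have hhigh : a + a + 1 < 2 * c + 1 ↔ a + a + 2 < 2 * c + 1 := by omega
  rw [pathShift]
  simp only [hlow, hhigh]
  congr 1
  · refine if_ctx_congr Iff.rfl (fun h => ?_) fun _ => rfl
    rw [pathShift, if_pos (by omega), if_pos (by omega)]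
    congr 2
    omega
  · refine if_ctx_congr Iff.rfl (fun h => ?_) fun _ => rfl
    rw [pathShift, if_pos (by omega), if_pos (by omega)]
    simp

/-- If `d` is the degree of `u`, the numbers of closed walks at `u` of length `2` and `4` are `d` and
`d ^ 2 + d`, so the left-hand side is `(d - 1) * (d - 2) / 2`, and `d` is `1` or `2`. -/
theorem adjMatrix_pathGraph_quartic_apply_self {n : ℕ} (hn : 3 ≤ n) (hodd : Odd n) (u : Fin n)
    (hu : Even (u : ℕ)) :
    ((SimpleGraph.pathGraph n).adjMatrix ℂ ^ 4) u u / 2 -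
      2 * ((SimpleGraph.pathGraph n).adjMatrix ℂ ^ 2) u u + 1 = 0 := by
  rw [adjMatrix_pathGraph_pow_apply_self, adjMatrix_pathGraph_pow_apply_self]
  obtain ⟨v, hv⟩ := u
  simp only [Function.iterate_succ_apply, Function.iterate_zero_apply] at hu ⊢
  set δ : ℕ → ℂ := fun j => if j = v then 1 else 0 with hδ
  set y := pathShift n (pathShift n δ) with hy
  have hmid : y v = (if 2 ≤ v then 1 else 0) + (if v + 2 < n then 1 else 0) := by
    rw [hy, pathShift_pathShift_apply hodd _ hv hu]
    have : 2 ≤ v → v - 2 ≠ v := by omega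
    congr 1 <;> split_ifs <;> simp_all
  have hlow : 2 ≤ v → y (v - 2) = 1 := fun h => by
    rw [hy, pathShift_pathShift_apply hodd _ (by omega) (hu.tsub even_two),
      if_pos (by omega : v - 2 + 2 < n)]
    simp only [hδ]
    rw [if_neg (by omega : ¬ v - 2 - 2 = v), if_neg (by omega : ¬ v - 2 = v),
      if_pos (by omega : v - 2 + 2 = v)]
    simp
  have hhigh : v + 2 < n → y (v + 2) = 1 := fun h => by
    rw [hy, pathShift_pathShift_apply hodd _ h (hu.add even_two), if_pos (by omega)]
    simp [hδ]
    omega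
  rw [pathShift_pathShift_apply hodd y hv hu]
  obtain ⟨a, rfl⟩ := hu
  obtain ⟨c, rfl⟩ := hodd
  by_cases h1 : 2 ≤ a + a <;> by_cases h2 : a + a + 2 < 2 * c + 1
  · simp only [if_pos h1, if_pos h2, hmid, hlow h1, hhigh h2]
    norm_num
  · simp only [if_pos h1, if_neg h2, hmid, hlow h1]
    norm_num
  · simp only [if_neg h1, if_pos h2, hmid, hhigh h2]
    norm_num
  -- Both conditions fail only for the one-vertex path.
  · omega

/-- The kernel equations `x (i - 1) + x (i + 1) = 0` carry the zero beyond either end of the path in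
steps of two: from the left end to the odd positions, and, for even `n`, from the right end to the
even ones. -/
theorem eq_zero_of_pathShift_eq_zero {n : ℕ} {x : ℕ → ℂ} (hx : ∀ i < n, pathShift n x i = 0)
    {u : ℕ} (hu : u < n) (h : Odd u ∨ Even n) : x u = 0 := by
  have hstep : ∀ i, i + 2 < n → x i + x (i + 2) = 0 := fun i hi => by
    have := hx (i + 1) (by omega)
    rwa [pathShift, if_pos (by omega), if_pos (by omega)] at this
  rcases Nat.even_or_odd' u with ⟨k, rfl | rfl⟩
  · have hdown : ∀ d i, i + 2 * d + 2 = n → x i = 0 := by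
      intro d
      induction d with
      | zero =>
        intro i hi
        have := hx (i + 1) (by omega)
        rwa [pathShift, if_pos (by omega), if_neg (by omega), add_zero] at this
      | succ d ih =>
        intro i hi
        have h1 := hstep i (by omega)
        rwa [ih (i + 2) (by omega), add_zero] at h1
    obtain ⟨m, rfl⟩ := h.resolve_left (by simp)
    exact hdown (m - k - 1) _ (by omega)
  · clear h
    induction k with
    | zero =>
      have := hx 0 (by omega)
      rwa [pathShift, if_neg (by omega), if_pos (by omega), zero_add] at this
    | succ k ih =>
      have h1 := hstep (2 * k + 1) (by omega)
      rwa [ih (by omega), zero_add] at h1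

/-! ### Sedentariness of paths -/

theorem mainTheorem10 (n : ℕ) (hn : 3 ≤ n) :
    IsNotSedentaryGraph (SimpleGraph.pathGraph n) ∧
    (Odd n → ∀ u : Fin n, Odd (u.val + 1) →
      (transitionMatrix (SimpleGraph.pathGraph n) (Real.pi / √2) u u).im = 0 ∧
      (transitionMatrix (SimpleGraph.pathGraph n) (Real.pi / √2) u u).re ≤ 0) := by
  set G := SimpleGraph.pathGraph n
  set hA := isHermitian_adjMatrix G
  have him : ∀ t u, (transitionMatrix G t u u).im = 0 :=
    transitionMatrix_apply_self_im G (SimpleGraph.pathGraph.bicoloring n)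
  have hnorm : ∀ t u, ‖transitionMatrix G t u u‖ = |(transitionMatrix G t u u).re| :=
    fun t u => (Complex.abs_re_eq_norm.mpr (him t u)).symm
  have hre : Odd n → ∀ u : Fin n, Odd (u.val + 1) →
      (transitionMatrix G (Real.pi / √2) u u).re ≤ 0 := by
    intro hodd u hu
    have hq := adjMatrix_pathGraph_quartic_apply_self hn hodd u (by grind)
    rw [hA.pow_apply_self, hA.pow_apply_self] at hq
    norm_cast at hq
    rw [transitionMatrix_apply_self_re]
    -- The spectral measure at `u` has total mass `1`: this is the diagonal entry of `A ^ 0`.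
    have h1 : (∑ j, ‖hA.eigenvectorBasis j u‖ ^ 2 : ℝ) = 1 := by
      have := hA.pow_apply_self 0 u
      simp only [pow_zero, Matrix.one_apply_eq, mul_one] at this
      exact_mod_cast this.symm
    calc _ ≤ ∑ j, ‖hA.eigenvectorBasis j u‖ ^ 2 *
          (hA.eigenvalues j ^ 4 / 2 - 2 * hA.eigenvalues j ^ 2 + 1) :=
          Finset.sum_le_sum fun j _ =>
            mul_le_mul_of_nonneg_left (cos_mul_pi_div_sqrt_two_le _) (by positivity)
      _ = (∑ j, ‖hA.eigenvectorBasis j u‖ ^ 2 * hA.eigenvalues j ^ 4) / 2 -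
          2 * (∑ j, ‖hA.eigenvectorBasis j u‖ ^ 2 * hA.eigenvalues j ^ 2) +
          ∑ j, ‖hA.eigenvectorBasis j u‖ ^ 2 := by
          rw [Finset.sum_div, Finset.mul_sum, ← Finset.sum_sub_distrib, ← Finset.sum_add_distrib]
          exact Finset.sum_congr rfl fun j _ => by ring
      _ = 0 := by rw [h1]; exact_mod_cast hq
      _ ≤ 0 := le_rfl
  refine ⟨fun u => ?_, fun hodd u hu => ⟨him _ u, hre hodd u hu⟩⟩
  refine isNotSedentaryVertex_of_forall_exists G u fun ε hε => ?_
  by_cases hcase : Odd n ∧ Odd (u.val + 1)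
  · have hcont : Continuous fun t => (transitionMatrix G t u u).re := by
      simp only [transitionMatrix_apply_self_re]
      fun_prop
    have h0 : (transitionMatrix G 0 u u).re = 1 := by simp [transitionMatrix]
    have hpos : 0 ≤ Real.pi / √2 := by positivity
    obtain ⟨t, ht, hzero⟩ := intermediate_value_Icc' hpos hcont.continuousOn
      (show (0 : ℝ) ∈ Set.Icc _ _ from ⟨hre hcase.1 u hcase.2, by simp [h0]⟩)
    refine ⟨t, lt_of_le_of_ne ht.1 ?_, ?_⟩
    · rintro rfl
      exact one_ne_zero (h0.symm.trans hzero)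
    · rw [hnorm, show (transitionMatrix G t u u).re = 0 from hzero, abs_zero]
      exact hε.le
  · have hker : ∀ j ∈ Finset.univ, hA.eigenvalues j = 0 →
        ‖hA.eigenvectorBasis j u‖ ^ 2 = 0 := by
      intro j _ hj
      have hv := hA.mulVec_eigenvectorBasis j
      rw [hj, zero_smul] at hv
      -- Extend the eigenvector to `ℕ` by zero, as `pathShift` expects.
      set x : ℕ → ℂ := fun i => if h : i < n then hA.eigenvectorBasis j ⟨i, h⟩ else 0 with hx
      have hxv : (fun i : Fin n => x i) = ⇑(hA.eigenvectorBasis j) := by ext i; simp [hx]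
      rw [← hxv, adjMatrix_pathGraph_mulVec] at hv
      have := eq_zero_of_pathShift_eq_zero (fun i hi => congrFun hv ⟨i, hi⟩) u.isLt (by grind)
      rw [← congrFun hxv u, this]
      simp
    obtain ⟨t, ht, hle⟩ := exists_abs_sum_mul_cos_le Finset.univ _ _ hker hε
    exact ⟨t, ht, by rwa [hnorm, transitionMatrix_apply_self_re]⟩
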